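/- Graphs are finite, simple and undirected. A \emph{split graph} is a graph whose vertex set can be partitioned into a clique and an independent set. A \emph{clique transversal} of a graph $G$ is a set of vertices that intersects every inclusion-maximal clique of $G$; it is \emph{minimal} if it does not contain any other clique transversal of $G$. The decision problem \textsc{Upper Clique Transversal} (UCT) takes as input a graph $G$ and an integer $k$, and asks whether $G$ contains a minimal clique transversal $S$ with $|S|\ge k$. \textbf{Corollary.} \textsc{Upper Clique Transversal} can be solved in linear time in the class of split graphs. Precisely: there are a program $P$ for a random access machine and a constant $c$ such that, for every split graph $G$ with vertex set $\{0,\dots,n-1\}$ and $m$ edges, given by adjacency lists (with the neighbours in arbitrary order), and for every integer $k$, the program $P$ on input $(G,k)$ halts after at most $c\,(n+m+1)$ steps, with output $1$ if $G$ contains a minimal clique transversal $S$ with $|S|\ge k$, and with output $0$ otherwise. Here the machine has unit cost: each instruction (assignment, addition or subtraction of two words, one memory read or write through an address held in a register) and each comparison of two words counts as one step. Its words have $O(\log(n+m+|k|))$ bits: all integers that occur during the computation have absolute value at most $c\,(n+m+|k|+1)$. -/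

import Mathlib

/-! ### Split graphs, clique transversals, and the decision problem -/

/-- A split graph: the vertex set is partitioned into a clique `K` and an independent set `I`
(either part may be empty). -/
def IsSplitGraph {V : Type*} (G : SimpleGraph V) : Prop :=
  ∃ K I : Set V, G.IsClique K ∧ G.IsIndepSet I ∧ K ∩ I = ∅ ∧ K ∪ I = Set.univ

/-- A clique transversal: a set of vertices that meets every (inclusion-)maximal clique. -/
def IsCliqueTransversal {V : Type*} (G : SimpleGraph V) (S : Set V) : Prop :=
  ∀ C : Set V, Maximal G.IsClique C → (S ∩ C).Nonempty

/-- The yes-instances `(G, k)` of Upper Clique Transversal: `G` has an inclusion-minimal clique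
transversal with at least `k` vertices. -/
def UpperCliqueTransversal {n : ℕ} (G : SimpleGraph (Fin n)) (k : ℤ) : Prop :=
  ∃ S : Set (Fin n), Minimal (IsCliqueTransversal G) S ∧ k ≤ (S.ncard : ℤ)

/-! ### A random access machine with bounded words and unit cost

Programs are structured (sequencing, branching, while loops).  The machine has registers and an
addressable memory, whose cells hold integers; the only arithmetic is addition and subtraction. -/

namespace RAM

/-- An operand: the content of a register, or an integer literal. -/
inductive Operand where
  | reg (i : ℕ)
  | lit (z : ℤ)

/-- A test comparing two operands. -/
inductive Test where
  | lt (a b : Operand)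
  | eq (a b : Operand)

/-- Programs. -/
inductive Program where
  | skip
  /-- `reg d := a` -/
  | move (d : ℕ) (a : Operand)
  /-- `reg d := a + b` -/
  | add (d : ℕ) (a b : Operand)
  /-- `reg d := a - b` -/
  | sub (d : ℕ) (a b : Operand)
  /-- `reg d := mem[a]` -/
  | load (d : ℕ) (a : Operand)
  /-- `mem[a] := b` -/
  | store (a b : Operand)
  | seq (p q : Program)
  | ite (c : Test) (p q : Program)
  | while (c : Test) (p : Program)

/-- A state of the machine: the contents of the registers and of the memory cells. -/
structure State where
  reg : ℕ → ℤ
  mem : ℕ → ℤ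

/-- The value of an operand. -/
def Operand.val (s : State) : Operand → ℤ
  | .reg i => s.reg i
  | .lit z => z

/-- The truth of a test. -/
def Test.holds (s : State) : Test → Prop
  | .lt a b => a.val s < b.val s
  | .eq a b => a.val s = b.val s

/-- Write `z` into register `d`. -/
def State.setReg (s : State) (d : ℕ) (z : ℤ) : State :=
  { s with reg := Function.update s.reg d z }

/-- Write `z` into the memory cell with address `a`. -/
def State.setMem (s : State) (a : ℕ) (z : ℤ) : State :=
  { s with mem := Function.update s.mem a z }

/-- `Exec W p s t s'`: on a machine whose words hold the integers of absolute value at most `W`,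
the program `p`, started in state `s`, halts in state `s'` after exactly `t` steps.  Every
instruction and every evaluation of a test is one step.  A computation that overflows a word, or
uses a negative address or one that exceeds `W`, is stuck: it does not halt. -/
inductive Exec (W : ℕ) : Program → State → ℕ → State → Prop
  | skip (s : State) : Exec W .skip s 1 s
  | move (s : State) (d : ℕ) (a : Operand) (h : |a.val s| ≤ W) :
      Exec W (.move d a) s 1 (s.setReg d (a.val s))
  | add (s : State) (d : ℕ) (a b : Operand) (h : |a.val s + b.val s| ≤ W) :
      Exec W (.add d a b) s 1 (s.setReg d (a.val s + b.val s))
  | sub (s : State) (d : ℕ) (a b : Operand) (h : |a.val s - b.val s| ≤ W) :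
      Exec W (.sub d a b) s 1 (s.setReg d (a.val s - b.val s))
  | load (s : State) (d : ℕ) (a : Operand) (x : ℕ) (hx : a.val s = x) (hW : x ≤ W)
      (h : |s.mem x| ≤ W) :
      Exec W (.load d a) s 1 (s.setReg d (s.mem x))
  | store (s : State) (a b : Operand) (x : ℕ) (hx : a.val s = x) (hW : x ≤ W)
      (h : |b.val s| ≤ W) :
      Exec W (.store a b) s 1 (s.setMem x (b.val s))
  | seq {p q : Program} {s s' s'' : State} {t t' : ℕ}
      (hp : Exec W p s t s') (hq : Exec W q s' t' s'') :
      Exec W (.seq p q) s (t + t') s''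
  | ite_true {c : Test} {p q : Program} {s s' : State} {t : ℕ}
      (hc : c.holds s) (hp : Exec W p s t s') :
      Exec W (.ite c p q) s (t + 1) s'
  | ite_false {c : Test} {p q : Program} {s s' : State} {t : ℕ}
      (hc : ¬ c.holds s) (hq : Exec W q s t s') :
      Exec W (.ite c p q) s (t + 1) s'
  | while_true {c : Test} {p : Program} {s s' s'' : State} {t t' : ℕ}
      (hc : c.holds s) (hp : Exec W p s t s') (hw : Exec W (.while c p) s' t' s'') :
      Exec W (.while c p) s (t + t' + 1) s''
  | while_false {c : Test} {p : Program} {s : State} (hc : ¬ c.holds s) :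
      Exec W (.while c p) s 1 s

/-- The initial state on a given input: the input words stand in the first memory cells; all other
cells and all registers are `0`. -/
def initial (w : List ℤ) : State where
  reg := fun _ => 0
  mem := fun i => w.getD i 0

end RAM

/-! ### Adjacency lists as input -/

/-- `adj` is an adjacency-list representation of `G`: `adj v` lists the neighbours of `v`, each one
once, in an arbitrary order. -/
def IsAdjacencyLists {n : ℕ} (G : SimpleGraph (Fin n)) (adj : Fin n → List (Fin n)) : Prop :=
  ∀ v, (adj v).Nodup ∧ ∀ u, u ∈ adj v ↔ G.Adj v u

/-- The address of the first entry of the list of vertex `i`, for `i < n`; for `i = n`, the first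
address after the input. -/
def listStart {n : ℕ} (adj : Fin n → List (Fin n)) (i : ℕ) : ℕ :=
  n + 3 + ((List.ofFn adj).take i).flatten.length

/-- The input words of an instance: `n`, `k`, the `n + 1` addresses `listStart adj 0, …,
listStart adj n`, and then the lists `adj 0, …, adj (n - 1)`, one after the other. -/
def inputWords {n : ℕ} (adj : Fin n → List (Fin n)) (k : ℤ) : List ℤ :=
  [(n : ℤ), k] ++ (List.range (n + 1)).map (fun i => (listStart adj i : ℤ)) ++
    ((List.ofFn adj).flatten.map fun u => ((u : ℕ) : ℤ))

/-! ### Minimal clique transversals of split graphs -/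

section Graph

variable {V : Type*} {G : SimpleGraph V}

/-- The non-neighbours of a vertex (itself included) form a clique transversal. -/
theorem isCliqueTransversal_compl_neighborSet (s : V) :
    IsCliqueTransversal G (G.neighborSet s)ᶜ := by
  intro C hC
  by_contra h
  rw [Set.not_nonempty_iff_eq_empty] at h
  have hsub : ∀ x ∈ C, G.Adj s x := by
    intro x hx
    by_contra hn
    have : x ∈ (G.neighborSet s)ᶜ ∩ C := ⟨hn, hx⟩
    simp [h] at this
  have hcl : G.IsClique (insert s C) := hC.prop.insert fun x hx _ => hsub x hx
  have hs : s ∈ C := hC.le_of_ge hcl (Set.subset_insert s C) (Set.mem_insert s C)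
  exact G.loopless.irrefl s (hsub s hs)

/-- Every vertex of a minimal clique transversal is the only one in some maximal clique. -/
theorem Minimal.exists_private_clique {S : Set V} (hS : Minimal (IsCliqueTransversal G) S)
    {x : V} (hx : x ∈ S) :
    ∃ C, Maximal G.IsClique C ∧ x ∈ C ∧ ∀ y ∈ S, y ∈ C → y = x := by
  by_contra! h
  have hT : IsCliqueTransversal G (S \ {x}) := by
    intro C hC
    by_cases hxC : x ∈ C
    · obtain ⟨y, hy, hyC, hne⟩ := h C hC hxC
      exact ⟨y, ⟨hy, hne⟩, hyC⟩
    · obtain ⟨y, hy, hyC⟩ := hS.prop C hC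
      exact ⟨y, ⟨hy, fun e => hxC (e ▸ hyC)⟩, hyC⟩
  exact (hS.le_of_le hT Set.sdiff_subset hx).2 rfl

variable {K : Set V}

/-- The closed neighbourhood of a vertex whose neighbours form a clique is a maximal clique. -/
theorem maximal_isClique_insert_neighborSet (hK : G.IsClique K) {v : V}
    (hv : G.neighborSet v ⊆ K) : Maximal G.IsClique (insert v (G.neighborSet v)) := by
  refine ⟨(hK.subset hv).insert fun x hx _ => hx, fun C hC hsub x hx => ?_⟩
  by_cases hxv : x = v
  · exact Or.inl hxv
  · exact Or.inr (hC (hsub (Set.mem_insert _ _)) hx (Ne.symm hxv))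

/-- A maximal clique through a vertex whose neighbours form a clique is its closed
neighbourhood. -/
theorem eq_insert_neighborSet_of_mem {C : Set V} (hC : Maximal G.IsClique C) (hK : G.IsClique K)
    {v : V} (hv : G.neighborSet v ⊆ K) (hvC : v ∈ C) : C = insert v (G.neighborSet v) := by
  refine hC.eq_of_subset (maximal_isClique_insert_neighborSet hK hv).prop fun x hx => ?_
  by_cases hxv : x = v
  · exact Or.inl hxv
  · exact Or.inr (hC.prop hvC hx (Ne.symm hxv))

/-- The vertices outside `K` have all their neighbours in `K`. -/
theorem neighborSet_subset_of_isIndepSet_compl (hI : G.IsIndepSet Kᶜ) {v : V} (hv : v ∉ K) :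
    G.neighborSet v ⊆ K := by
  intro u hu
  by_contra h
  exact hI hv h (G.ne_of_adj hu) hu

/-- For a maximal clique `K` with independent complement, the non-neighbours of a vertex of `K`
form a minimal clique transversal. -/
theorem minimal_compl_neighborSet (hK : Maximal G.IsClique K) (hI : G.IsIndepSet Kᶜ) {s : V}
    (hs : s ∈ K) : Minimal (IsCliqueTransversal G) (G.neighborSet s)ᶜ := by
  refine ⟨isCliqueTransversal_compl_neighborSet s, fun S' hS' hle v hv => ?_⟩
  have key : ∀ x ∈ K, x ∈ S' → x = s := fun x hxK hxS => by
    by_contra hne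
    exact hle hxS (hK.prop hs hxK (Ne.symm hne))
  by_cases hvK : v ∈ K
  · obtain ⟨x, hxS, hxK⟩ := hS' K hK
    have hvs : v = s := by
      by_contra hne
      exact hv (hK.prop hs hvK (Ne.symm hne))
    rw [hvs, ← key x hxK hxS]
    exact hxS
  · have hsub := neighborSet_subset_of_isIndepSet_compl hI hvK
    obtain ⟨x, hxS, rfl | hx⟩ := hS' _ (maximal_isClique_insert_neighborSet hK.prop hsub)
    · exact hxS
    · have := key x (hsub hx) hxS
      subst this
      exact absurd (G.adj_symm hx) hv

/-- A minimal clique transversal has at most as many vertices as the set of non-neighbours of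
any vertex that it shares with `K`. -/
theorem ncard_le_ncard_compl_neighborSet [Finite V] (hK : Maximal G.IsClique K)
    (hI : G.IsIndepSet Kᶜ) {S : Set V} (hS : Minimal (IsCliqueTransversal G) S) {a : V}
    (haS : a ∈ S) (haK : a ∈ K) : S.ncard ≤ (G.neighborSet a)ᶜ.ncard := by
  have hex : ∀ x ∈ S, ∃ v, ¬ G.Adj a v ∧ (v = a ∧ x = a ∨ v ∉ K ∧
      ∀ y ∈ S, y ∈ insert v (G.neighborSet v) ↔ y = x) := by
    intro x hx
    by_cases hxa : x = a
    · exact ⟨a, G.loopless.irrefl a, Or.inl ⟨rfl, hxa⟩⟩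
    obtain ⟨C, hC, hxC, hpriv⟩ := hS.exists_private_clique hx
    have haC : a ∉ C := fun h => hxa (hpriv a haS h).symm
    have hCK : ¬ C ⊆ K := fun h => haC (hC.eq_of_subset hK.prop h ▸ haK)
    obtain ⟨v, hvC, hvK⟩ := Set.not_subset.1 hCK
    have hCv := eq_insert_neighborSet_of_mem hC hK.prop
      (neighborSet_subset_of_isIndepSet_compl hI hvK) hvC
    refine ⟨v, fun h => haC ?_, Or.inr ⟨hvK, fun y hy => ⟨fun h => ?_, ?_⟩⟩⟩
    · rw [hCv]
      exact Or.inr (G.adj_symm h)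
    · exact hpriv y hy (hCv ▸ h)
    · rintro rfl
      rwa [← hCv]
  choose! f hf using hex
  refine Set.ncard_le_ncard_of_injOn f (fun x hx => (hf x hx).1) ?_ (Set.toFinite _)
  intro x hx y hy hxy
  rcases (hf x hx).2 with ⟨h1, rfl⟩ | ⟨h1, h2⟩
  · rcases (hf y hy).2 with ⟨h3, rfl⟩ | ⟨h3, h4⟩
    · rfl
    · exact absurd haK (by rwa [← hxy, h1] at h3)
  · rcases (hf y hy).2 with ⟨h3, rfl⟩ | ⟨h3, h4⟩
    · exact absurd haK (by rwa [hxy, h3] at h1)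
    · exact (h4 x hx).1 (hxy ▸ (h2 x hx).2 rfl)

/-- A finite split graph has a maximal clique with independent complement. -/
theorem IsSplitGraph.exists_maximal_isClique [Finite V] (hG : IsSplitGraph G) :
    ∃ K, Maximal G.IsClique K ∧ G.IsIndepSet Kᶜ := by
  obtain ⟨K, I, hK, hI, hd, hu⟩ := hG
  have hIK : Kᶜ ⊆ I := fun x hx => ((hu ▸ Set.mem_univ x : x ∈ K ∪ I)).resolve_left hx
  obtain ⟨M, hKM, hM⟩ := (Set.toFinite {C : Set V | G.IsClique C}).exists_le_maximal hK
  exact ⟨M, hM, hI.mono ((Set.compl_subset_compl.2 hKM).trans hIK)⟩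

end Graph

/-- In a split graph, the yes-instances are recognized from the degrees. -/
theorem upperCliqueTransversal_iff {n : ℕ} {G : SimpleGraph (Fin n)} {k : ℤ}
    (hG : IsSplitGraph G) {E : ℕ}
    (h1 : E ≤ {v | E ≤ (G.neighborSet v).ncard + 1}.ncard)
    (h2 : {v | E + 1 ≤ (G.neighborSet v).ncard + 1}.ncard ≤ E) :
    UpperCliqueTransversal G k ↔ {v | (n : ℤ) - k < (G.neighborSet v).ncard}.ncard < E := by
  obtain ⟨K, hK, hI⟩ := hG.exists_maximal_isClique
  have hdK : ∀ v ∈ K, K.ncard ≤ (G.neighborSet v).ncard + 1 := by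
    intro v hv
    refine le_trans (Set.ncard_le_ncard (t := insert v (G.neighborSet v)) ?_)
      (Set.ncard_insert_le _ _)
    intro x hx
    by_cases hxv : x = v
    · exact Or.inl hxv
    · exact Or.inr (hK.prop hv hx (Ne.symm hxv))
  have hdI : ∀ v ∉ K, (G.neighborSet v).ncard < K.ncard := by
    intro v hv
    refine Set.ncard_lt_ncard ((neighborSet_subset_of_isIndepSet_compl hI hv).ssubset_of_ne ?_)
    intro h
    refine hv (hK.le_of_ge (y := insert v K) ?_ (Set.subset_insert _ _) (Set.mem_insert _ _))
    refine hK.prop.insert fun x hx _ => ?_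
    rwa [← h] at hx
  have hE : K.ncard = E := by
    apply le_antisymm
    · by_contra! h
      have : K ⊆ {v | E + 1 ≤ (G.neighborSet v).ncard + 1} := fun v hv => h.trans_le (hdK v hv)
      have := Set.ncard_le_ncard this
      omega
    · by_contra! h
      have : {v | E ≤ (G.neighborSet v).ncard + 1} ⊆ K := fun v hv => by
        by_contra hvK
        have := hdI v hvK
        simp only [Set.mem_ofPred_eq] at hv
        omega
      have := Set.ncard_le_ncard this
      omega
  have hcompl : ∀ s, (G.neighborSet s)ᶜ.ncard + (G.neighborSet s).ncard = n := fun s => by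
    have := Set.ncard_add_ncard_compl (G.neighborSet s)
    rw [Nat.card_eq_fintype_card, Fintype.card_fin] at this
    omega
  have hmain : UpperCliqueTransversal G k ↔
      ∃ s ∈ K, ((G.neighborSet s).ncard : ℤ) ≤ (n : ℤ) - k := by
    constructor
    · rintro ⟨S, hS, hk⟩
      obtain ⟨a, haS, haK⟩ := hS.prop K hK
      have h := ncard_le_ncard_compl_neighborSet hK hI hS haS haK
      have := hcompl a
      exact ⟨a, haK, by omega⟩
    · rintro ⟨s, hs, hk⟩
      have := hcompl s
      exact ⟨_, minimal_compl_neighborSet hK hI hs, by omega⟩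
  rw [hmain, ← hE]
  constructor
  · rintro ⟨s, hs, hk⟩
    refine Set.ncard_lt_ncard ⟨fun v hv => ?_, fun h => absurd (h hs) ?_⟩
    · by_contra hvK
      have := hdI v hvK
      have := hdK s hs
      simp only [Set.mem_ofPred_eq] at hv
      omega
    · simpa using hk
  · intro h
    by_contra! hn
    have hsub : K ⊆ {v | (n : ℤ) - k < (G.neighborSet v).ncard} := hn
    exact absurd (Set.ncard_le_ncard hsub) (by omega)

/-! ### Total correctness with time bounds -/

namespace RAM

/-- The program halts within `T` steps in a state that satisfies `Q`. -/
def Halts (W : ℕ) (p : Program) (s : State) (T : ℕ) (Q : State → Prop) : Prop :=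
  ∃ t s', Exec W p s t s' ∧ t ≤ T ∧ Q s'

variable {W : ℕ} {p q : Program} {s : State} {T T' : ℕ} {Q R : State → Prop}

theorem Halts.mono (h : Halts W p s T Q) (hT : T ≤ T') (hQ : ∀ s, Q s → R s) :
    Halts W p s T' R := by
  obtain ⟨t, s', he, ht, hs⟩ := h
  exact ⟨t, s', he, ht.trans hT, hQ _ hs⟩

theorem Halts.seq (h : Halts W p s T fun s' => Halts W q s' T' Q) :
    Halts W (.seq p q) s (T + T') Q := by
  obtain ⟨t, s', he, ht, t', s'', he', ht', hs⟩ := h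
  exact ⟨_, s'', he.seq he', by omega, hs⟩

theorem Halts.skip (h : Q s) : Halts W .skip s 1 Q := ⟨_, _, .skip s, le_rfl, h⟩

theorem Halts.move {d : ℕ} {a : Operand} (z : ℤ) (hz : a.val s = z) (hW : |z| ≤ W)
    (h : Q (s.setReg d z)) : Halts W (.move d a) s 1 Q := by
  subst hz
  exact ⟨_, _, .move s d a hW, le_rfl, h⟩

theorem Halts.add {d : ℕ} {a b : Operand} (z : ℤ) (hz : a.val s + b.val s = z) (hW : |z| ≤ W)
    (h : Q (s.setReg d z)) : Halts W (.add d a b) s 1 Q := by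
  subst hz
  exact ⟨_, _, .add s d a b hW, le_rfl, h⟩

theorem Halts.sub {d : ℕ} {a b : Operand} (z : ℤ) (hz : a.val s - b.val s = z) (hW : |z| ≤ W)
    (h : Q (s.setReg d z)) : Halts W (.sub d a b) s 1 Q := by
  subst hz
  exact ⟨_, _, .sub s d a b hW, le_rfl, h⟩

theorem Halts.load {d : ℕ} {a : Operand} (x : ℕ) (z : ℤ) (hx : a.val s = x) (hz : s.mem x = z)
    (hxW : x ≤ W) (hW : |z| ≤ W) (h : Q (s.setReg d z)) : Halts W (.load d a) s 1 Q := by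
  subst hz
  exact ⟨_, _, .load s d a x hx hxW hW, le_rfl, h⟩

theorem Halts.store {a b : Operand} (x : ℕ) (z : ℤ) (hx : a.val s = x) (hz : b.val s = z)
    (hxW : x ≤ W) (hW : |z| ≤ W) (h : Q (s.setMem x z)) : Halts W (.store a b) s 1 Q := by
  subst hz
  exact ⟨_, _, .store s a b x hx hxW hW, le_rfl, h⟩

theorem Halts.ite {c : Test} (hp : c.holds s → Halts W p s T Q)
    (hq : ¬ c.holds s → Halts W q s T Q) : Halts W (.ite c p q) s (T + 1) Q := by
  by_cases hc : c.holds s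
  · obtain ⟨t, s', he, ht, hs⟩ := hp hc
    exact ⟨_, s', he.ite_true hc, by omega, hs⟩
  · obtain ⟨t, s', he, ht, hs⟩ := hq hc
    exact ⟨_, s', he.ite_false hc, by omega, hs⟩

/-- The loop rule: `I v` is the invariant, and the variant `v` decreases by one. -/
theorem Halts.while {c : Test} (I : ℕ → State → Prop)
    (hI : ∀ v s, I v s → c.holds s → ∃ v', v = v' + 1 ∧ Halts W p s T (I v')) :
    ∀ v s, I v s →
      Halts W (.while c p) s ((T + 1) * v + 1) fun s' => ∃ v, I v s' ∧ ¬ c.holds s' := by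
  intro v
  induction v with
  | zero =>
    intro s hs
    refine ⟨1, s, .while_false fun hc => ?_, by omega, 0, hs, fun hc => ?_⟩ <;>
    · obtain ⟨v', hv, -⟩ := hI 0 s hs hc
      omega
  | succ v ih =>
    intro s hs
    by_cases hc : c.holds s
    · obtain ⟨v', hv, t, s', he, ht, hs'⟩ := hI _ s hs hc
      obtain rfl : v' = v := by omega
      obtain ⟨t', s'', he', ht', hs''⟩ := ih s' hs'
      exact ⟨_, s'', .while_true hc he he', by rw [Nat.mul_succ]; omega, hs''⟩
    · exact ⟨1, s, .while_false hc, by omega, v + 1, hs, hc⟩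

/-! ### The program -/

/-- The loop that computes the degree of each vertex `reg 5`, counts in `reg 10` the degrees above
`reg 9`, and in the memory cells after the input the vertices of each degree. -/
def degreeLoop : Program :=
  .while (.lt (.reg 5) (.reg 1)) <|
    .seq (.add 6 (.reg 5) (.lit 2)) <|
    .seq (.load 7 (.reg 6)) <|
    .seq (.add 6 (.reg 6) (.lit 1)) <|
    .seq (.load 8 (.reg 6)) <|
    .seq (.sub 8 (.reg 8) (.reg 7)) <|
    .seq (.ite (.lt (.reg 9) (.reg 8)) (.add 10 (.reg 10) (.lit 1)) .skip) <|
    .seq (.add 6 (.reg 4) (.reg 8)) <|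
    .seq (.add 6 (.reg 6) (.lit 1)) <|
    .seq (.load 7 (.reg 6)) <|
    .seq (.add 7 (.reg 7) (.lit 1)) <|
    .seq (.store (.reg 6) (.reg 7)) <|
    .add 5 (.reg 5) (.lit 1)

/-- The loop that finds, in `reg 11`, the largest `E` such that at least `E` vertices have degree
at least `E - 1`. -/
def cliqueNumberLoop : Program :=
  .while (.lt (.reg 12) (.reg 11)) <|
    .seq (.sub 11 (.reg 11) (.lit 1)) <|
    .seq (.add 6 (.reg 4) (.reg 11)) <|
    .seq (.load 7 (.reg 6)) <|
    .add 12 (.reg 12) (.reg 7)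

/-- The program for Upper Clique Transversal in split graphs. -/
def splitUCT : Program :=
  .seq (.load 1 (.lit 0)) <|
  .seq (.load 2 (.lit 1)) <|
  .seq (.add 3 (.reg 1) (.lit 2)) <|
  .seq (.load 4 (.reg 3)) <|
  .seq (.sub 9 (.reg 1) (.reg 2)) <|
  .seq degreeLoop <|
  .seq (.add 11 (.reg 1) (.lit 1)) <|
  .seq cliqueNumberLoop <|
  .ite (.lt (.reg 10) (.reg 11)) (.move 0 (.lit 1)) (.move 0 (.lit 0))

variable {n B : ℕ} {k : ℤ} {d a : ℕ → ℕ}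

/-- The invariant of `degreeLoop`, with `i` vertices done. -/
structure DegreeInv (n B : ℕ) (k : ℤ) (d a : ℕ → ℕ) (i : ℕ) (s : State) : Prop where
  le : i ≤ n
  reg1 : s.reg 1 = n
  reg4 : s.reg 4 = B
  reg5 : s.reg 5 = i
  reg9 : s.reg 9 = n - k
  reg10 : s.reg 10 = Nat.count (fun v => (n : ℤ) - k < d v) i
  reg12 : s.reg 12 = 0
  mem_input : ∀ i ≤ n, s.mem (i + 2) = a i
  mem_count : ∀ j, s.mem (B + j) = Nat.count (fun v => d v + 1 = j) i

set_option maxHeartbeats 1000000 in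
theorem halts_degreeLoop (ha : ∀ i < n, a (i + 1) = a i + d i) (hd : ∀ i < n, d i < n)
    (haB : ∀ i ≤ n, a i ≤ B) (hnB : n + 2 < B) (hW : B + n + 1 ≤ W) {s : State}
    (hs : DegreeInv n B k d a 0 s) :
    Halts W degreeLoop s (14 * n + 1) (DegreeInv n B k d a n) := by
  refine (Halts.while (T := 13) (fun v s => ∃ i, i + v = n ∧ DegreeInv n B k d a i s) ?_ n s
    ⟨0, by omega, hs⟩).mono le_rfl ?_
  · rintro v s ⟨i, hiv, hs⟩ hc
    have hin : i < n := by
      have : s.reg 5 < s.reg 1 := hc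
      rw [hs.reg5, hs.reg1] at this
      exact_mod_cast this
    refine ⟨v - 1, by omega, ?_⟩
    have hai := ha i hin
    have hdi := hd i hin
    have hB := haB (i + 1) hin
    have hcnt : Nat.count (fun v => (n : ℤ) - k < d v) i ≤ i := Nat.count_le _
    have hcnt' : Nat.count (fun v => d v + 1 = d i + 1) i ≤ i := Nat.count_le _
    obtain ⟨-, h1, h4, h5, h9, h10, h12, hm, hmc⟩ := hs
    refine Halts.seq (T := 1) (T' := 12) (.add (i + 2) (by simp [Operand.val, h5]) (by grind) ?_)
    refine Halts.seq (T := 1) (T' := 11) (.load (i + 2) (a i) (by simp [Operand.val, State.setReg])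
      (by simp [State.setReg, hm i hin.le]) (by omega) (by grind) ?_)
    refine Halts.seq (T := 1) (T' := 10) (.add (i + 3)
      (by simp [Operand.val, State.setReg]; ring) (by grind) ?_)
    refine Halts.seq (T := 1) (T' := 9) (.load (i + 1 + 2) (a (i + 1))
      (by simp [Operand.val, State.setReg]; ring)
      (by simpa [State.setReg] using hm (i + 1) hin) (by omega) (by grind) ?_)
    refine Halts.seq (T := 1) (T' := 8) (.sub (d i)
      (by simp [Operand.val, State.setReg, hai]) (by grind) ?_)
    set c : ℕ := Nat.count (fun v => (n : ℤ) - k < d v) (i + 1) with hc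
    have hci : c ≤ i + 1 := Nat.count_le _
    have hcs : c = Nat.count (fun v => (n : ℤ) - k < d v) i + if (n : ℤ) - k < d i then 1 else 0 :=
      Nat.count_succ _ _
    refine Halts.seq (T := 2) (T' := 6) (.mono (T := 2) (Q := fun s' =>
      s'.reg 1 = n ∧ s'.reg 4 = B ∧ s'.reg 5 = i ∧ s'.reg 8 = d i ∧ s'.reg 9 = n - k ∧
      s'.reg 10 = c ∧ s'.reg 12 = 0 ∧ s'.mem = s.mem) ?_ le_rfl ?_)
    · refine Halts.ite (T := 1) (fun h => .add c ?_ ?_ ?_) fun h => .skip ?_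
      · simp only [Test.holds, Operand.val, State.setReg] at h
        simp [h9] at h
        simp [Operand.val, State.setReg, h10, hcs, h]
      · grind
      · simp [State.setReg, h1, h4, h5, h9, h12]
      · simp only [Test.holds, Operand.val, State.setReg] at h
        simp [h9, -not_lt] at h
        simp [State.setReg, h1, h4, h5, h9, h12, h10, hcs, h]
    clear_value c
    clear h1 h4 h5 h9 h10 h12
    rintro s' ⟨h1, h4, h5, h8, h9, h10, h12, hmem⟩
    refine Halts.seq (T := 1) (T' := 5) (.add (B + d i)
      (by simp [Operand.val, h4, h8]) (by grind) ?_)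
    refine Halts.seq (T := 1) (T' := 4) (.add (B + d i + 1)
      (by simp [Operand.val, State.setReg]) (by grind) ?_)
    refine Halts.seq (T := 1) (T' := 3) (.load (B + (d i + 1))
      (Nat.count (fun v => d v + 1 = d i + 1) i)
      (by simp [Operand.val, State.setReg]; ring)
      (by simp only [State.setReg, hmem, hmc]) (by omega) (by grind) ?_)
    refine Halts.seq (T := 1) (T' := 2) (.add (Nat.count (fun v => d v + 1 = d i + 1) i + 1)
      (by simp [Operand.val, State.setReg]) (by grind) ?_)
    refine Halts.seq (T := 1) (T' := 1) (.store (B + (d i + 1))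
      (Nat.count (fun v => d v + 1 = d i + 1) i + 1)
      (by simp [Operand.val, State.setReg]; ring) (by simp [Operand.val, State.setReg])
      (by omega) (by grind) ?_)
    refine Halts.add (i + 1) (by simp [Operand.val, State.setReg, State.setMem, h5]) (by grind) ?_
    refine ⟨i + 1, by omega, by omega, ?_, ?_, ?_, ?_, ?_, ?_, fun j hj => ?_, fun j => ?_⟩
    · simp [State.setReg, State.setMem, h1]
    · simp [State.setReg, State.setMem, h4]
    · simp [State.setReg, State.setMem]
    · simp [State.setReg, State.setMem, h9]
    · simp [State.setReg, State.setMem, h10, hc]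
    · simp [State.setReg, State.setMem, h12]
    · have : j + 2 ≠ B + (d i + 1) := by omega
      simp [State.setReg, State.setMem, this, hmem, hm j hj]
    · rw [Nat.count_succ]
      by_cases hj : j = d i + 1
      · subst hj
        simp [State.setReg, State.setMem]
      · have : ¬ d i + 1 = j := Ne.symm hj
        simp [State.setReg, State.setMem, hj, this, hmem, hmc j]
  · rintro s ⟨v, ⟨i, hiv, hs⟩, hc⟩
    have : ¬ s.reg 5 < s.reg 1 := hc
    rw [hs.reg5, hs.reg1] at this
    obtain rfl : i = n := by omega
    exact hs

theorem count_le_succ_split (d : ℕ → ℕ) (E n : ℕ) :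
    Nat.count (fun v => E ≤ d v + 1) n =
      Nat.count (fun v => E + 1 ≤ d v + 1) n + Nat.count (fun v => d v + 1 = E) n := by
  induction n with
  | zero => simp
  | succ n ih =>
    simp only [Nat.count_succ, ih]
    split_ifs <;> omega

/-- The invariant of `cliqueNumberLoop`. -/
structure CliqueNumberInv (n B : ℕ) (d : ℕ → ℕ) (r : ℤ) (E : ℕ) (s : State) : Prop where
  le : E ≤ n + 1
  reg4 : s.reg 4 = B
  reg10 : s.reg 10 = r
  reg11 : s.reg 11 = E
  reg12 : s.reg 12 = Nat.count (fun v => E ≤ d v + 1) n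
  succ_le : Nat.count (fun v => E + 1 ≤ d v + 1) n ≤ E
  mem_count : ∀ j, s.mem (B + j) = Nat.count (fun v => d v + 1 = j) n

theorem halts_cliqueNumberLoop {r : ℤ} (hW : B + n + 1 ≤ W) {s : State}
    (hs : CliqueNumberInv n B d r (n + 1) s) :
    Halts W cliqueNumberLoop s (5 * (n + 1) + 1) fun s' => ∃ E : ℕ,
      E ≤ Nat.count (fun v => E ≤ d v + 1) n ∧ Nat.count (fun v => E + 1 ≤ d v + 1) n ≤ E ∧
      s'.reg 10 = r ∧ s'.reg 11 = E := by
  refine (Halts.while (T := 4) (CliqueNumberInv n B d r) ?_ (n + 1) s hs).mono le_rfl ?_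
  · rintro E s ⟨hle, h4, h10, h11, h12, hsucc, hmc⟩ hc
    replace hc : s.reg 12 < s.reg 11 := hc
    rw [h12, h11] at hc
    obtain ⟨E, rfl⟩ : ∃ E', E = E' + 1 := ⟨E - 1, by omega⟩
    have h1 : Nat.count (fun v => E ≤ d v + 1) n ≤ n := Nat.count_le _
    have h2 : Nat.count (fun v => d v + 1 = E) n ≤ n := Nat.count_le _
    refine ⟨E, rfl, ?_⟩
    refine Halts.seq (T := 1) (T' := 3) (.sub E (by simp [Operand.val, h11]) (by grind) ?_)
    refine Halts.seq (T := 1) (T' := 2) (.add (B + E)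
      (by simp [Operand.val, State.setReg, h4]) (by grind) ?_)
    refine Halts.seq (T := 1) (T' := 1) (.load (B + E) (Nat.count (fun v => d v + 1 = E) n)
      (by simp [Operand.val, State.setReg]) (by simp [State.setReg, hmc])
      (by omega) (by grind) ?_)
    refine Halts.add (Nat.count (fun v => E ≤ d v + 1) n)
      (by rw [count_le_succ_split]; simp [Operand.val, State.setReg, h12]) (by grind) ?_
    refine ⟨by omega, ?_, ?_, ?_, ?_, by omega, fun j => ?_⟩
    · simp [State.setReg, h4]
    · simp [State.setReg, h10]
    · simp [State.setReg]
    · simp [State.setReg]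
    · simp [State.setReg, hmc]
  · rintro s ⟨E, hs, hc⟩
    replace hc : ¬ s.reg 12 < s.reg 11 := hc
    rw [hs.reg12, hs.reg11] at hc
    exact ⟨E, by omega, hs.succ_le, hs.reg10, hs.reg11⟩

/-- The program on an input whose memory cells hold `n`, `k`, the list addresses `a i`, and
zeros from the address `B = a n` on. -/
theorem halts_splitUCT (ha : ∀ i < n, a (i + 1) = a i + d i) (hd : ∀ i < n, d i < n)
    (haB : ∀ i ≤ n, a i ≤ B) (hanB : a n = B) (hnB : n + 2 < B)
    (hW : B + n + k.natAbs + 1 ≤ W) {s : State} (hreg : ∀ i, s.reg i = 0)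
    (hm0 : s.mem 0 = n) (hm1 : s.mem 1 = k) (hm : ∀ i ≤ n, s.mem (i + 2) = a i)
    (hmB : ∀ j, s.mem (B + j) = 0) :
    Halts W splitUCT s (19 * n + 20) fun s' => ∃ E : ℕ,
      E ≤ Nat.count (fun v => E ≤ d v + 1) n ∧ Nat.count (fun v => E + 1 ≤ d v + 1) n ≤ E ∧
      s'.reg 0 = if Nat.count (fun v => (n : ℤ) - k < d v) n < E then 1 else 0 := by
  refine Halts.mono (T := 1 + (1 + (1 + (1 + (1 + ((14 * n + 1) +
    (1 + ((5 * (n + 1) + 1) + 2)))))))) ?_ (by omega) fun _ h => h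
  refine Halts.seq (.load 0 n (by simp [Operand.val]) hm0 (by omega) (by grind) ?_)
  refine Halts.seq (.load 1 k (by simp [Operand.val]) (by simp [State.setReg, hm1])
    (by omega) (by grind) ?_)
  refine Halts.seq (.add (n + 2) (by simp [Operand.val, State.setReg]) (by grind) ?_)
  refine Halts.seq (.load (n + 2) B (by simp [Operand.val, State.setReg])
    (by simp [State.setReg, hm n le_rfl, hanB]) (by omega) (by grind) ?_)
  refine Halts.seq (.sub (n - k) (by simp [Operand.val, State.setReg]) (by grind) ?_)
  refine Halts.seq (.mono (halts_degreeLoop ha hd haB hnB (by omega) (k := k) ?_) le_rfl ?_)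
  · refine ⟨by omega, ?_, ?_, ?_, ?_, ?_, ?_, ?_, ?_⟩ <;> simp [State.setReg, hreg, hmB]
    exact hm
  intro s hs
  refine Halts.seq (.add (n + 1) (by simp [Operand.val, hs.reg1]) (by grind) ?_)
  have hzero : ∀ E, n < E → Nat.count (fun v => E ≤ d v + 1) n = 0 := by
    intro E hE
    rw [Nat.count_iff_forall_not]
    intro i hi
    have := hd i hi
    omega
  refine Halts.seq (.mono (halts_cliqueNumberLoop (B := B) (d := d)
    (r := Nat.count (fun v => (n : ℤ) - k < d v) n) (by omega) ?_) le_rfl ?_)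
  · refine ⟨le_rfl, ?_, ?_, ?_, ?_, ?_, fun j => ?_⟩
    · simp [State.setReg, hs.reg4]
    · simp [State.setReg, hs.reg10]
    · simp [State.setReg]
    · rw [hzero _ (by omega)]
      simp [State.setReg, hs.reg12]
    · rw [hzero _ (by omega)]
      omega
    · simp [State.setReg, hs.mem_count]
  rintro s' ⟨E, h1, h2, h10, h11⟩
  refine Halts.ite (T := 1) (fun h => .move 1 rfl (by simp; omega) ⟨E, h1, h2, ?_⟩)
    fun h => .move 0 rfl (by simp) ⟨E, h1, h2, ?_⟩ <;>
  · simp only [Test.holds, Operand.val, h10, h11, Nat.cast_lt] at h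
    simp [State.setReg, h]

end RAM

/-! ### The input words -/

section Input

variable {n : ℕ} {adj : Fin n → List (Fin n)} {k : ℤ}

/-- The length of the list of vertex `i`. -/
def listLength (adj : Fin n → List (Fin n)) (i : ℕ) : ℕ :=
  if h : i < n then (adj ⟨i, h⟩).length else 0

theorem listStart_succ {i : ℕ} (hi : i < n) :
    listStart adj (i + 1) = listStart adj i + listLength adj i := by
  have hi' : i < (List.ofFn adj).length := by simpa using hi
  rw [listStart, listStart, List.take_succ_eq_append_getElem hi', List.flatten_append,
    List.length_append, listLength, dif_pos hi]
  simp [add_assoc]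

theorem listStart_mono {i j : ℕ} (hij : i ≤ j) : listStart adj i ≤ listStart adj j := by
  have h := (List.take_sublist_take_left (l := List.ofFn adj) hij).flatten.length_le
  simp only [listStart]
  omega

theorem listStart_self : listStart adj n = n + 3 + (List.ofFn adj).flatten.length := by
  rw [listStart, List.take_of_length_le (by simp)]

theorem length_inputWords : (inputWords adj k).length = listStart adj n := by
  rw [listStart_self]
  simp only [inputWords, List.bind_eq_flatMap, List.pure_def,
    ← List.map_eq_flatMap, List.length_append, List.length_map, List.length_range,
    List.length_cons, List.length_nil]
  omega

theorem getD_inputWords_add_two {i : ℕ} (hi : i ≤ n) :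
    (inputWords adj k).getD (i + 2) 0 = listStart adj i := by
  have : i < n + 1 := by omega
  simp [inputWords, List.getD, List.getElem?_append, this]

theorem IsAdjacencyLists.length_eq {G : SimpleGraph (Fin n)} (h : IsAdjacencyLists G adj)
    (v : Fin n) : (adj v).length = (G.neighborSet v).ncard := by
  rw [← List.toFinset_card_of_nodup (h v).1, ← Set.ncard_coe_finset]
  congr 1
  ext u
  simp [(h v).2]

theorem IsAdjacencyLists.length_flatten {G : SimpleGraph (Fin n)} (h : IsAdjacencyLists G adj) :
    (List.ofFn adj).flatten.length = 2 * G.edgeSet.ncard := by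
  classical
  have hs := G.sum_degrees_eq_twice_card_edges
  rw [List.length_flatten, List.map_ofFn, List.sum_ofFn, ← SimpleGraph.coe_edgeFinset,
    Set.ncard_coe_finset, ← hs]
  refine Finset.sum_congr rfl fun v _ => ?_
  rw [Function.comp_apply, h.length_eq, ← SimpleGraph.card_neighborSet_eq_degree,
    Set.ncard_eq_toFinset_card', Set.toFinset_card]

theorem ncard_eq_count (p : ℕ → Prop) [DecidablePred p] :
    {v : Fin n | p v}.ncard = Nat.count p n := by
  rw [Nat.count_eq_card_filter_range, ← Set.ncard_coe_finset,
    ← Set.ncard_image_of_injective _ Fin.val_injective]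
  congr 1
  ext i
  simp only [Set.mem_image, Set.mem_ofPred_eq, Finset.coe_filter, Finset.mem_range]
  exact ⟨fun ⟨v, hv, hvi⟩ => hvi ▸ ⟨v.2, hv⟩, fun ⟨hi, hp⟩ => ⟨⟨i, hi⟩, hp, rfl⟩⟩

end Input

theorem mainTheorem7 :
    ∃ (P : RAM.Program) (c : ℕ),
      ∀ (n : ℕ) (G : SimpleGraph (Fin n)) (adj : Fin n → List (Fin n)) (k : ℤ),
        IsSplitGraph G → IsAdjacencyLists G adj →
        ∃ (t : ℕ) (s : RAM.State),
          RAM.Exec (c * (n + G.edgeSet.ncard + k.natAbs + 1)) P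
            (RAM.initial (inputWords adj k)) t s ∧
          t ≤ c * (n + G.edgeSet.ncard + 1) ∧
          (UpperCliqueTransversal G k → s.reg 0 = 1) ∧
          (¬ UpperCliqueTransversal G k → s.reg 0 = 0) := by
  refine ⟨RAM.splitUCT, 20, fun n G adj k hG hadj => ?_⟩
  have hlen : ∀ v : Fin n, listLength adj v = (G.neighborSet v).ncard := fun v => by
    rw [listLength, dif_pos v.2, hadj.length_eq]
  have hlt : ∀ i < n, listLength adj i < n := fun i hi => by
    rw [hlen ⟨i, hi⟩]
    refine (Set.ncard_lt_card fun h => ?_).trans_eq (by simp)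
    have : (⟨i, hi⟩ : Fin n) ∈ G.neighborSet ⟨i, hi⟩ := h ▸ Set.mem_univ _
    exact G.loopless.irrefl _ this
  have hB := listStart_self (adj := adj)
  rw [hadj.length_flatten] at hB
  obtain ⟨t, s, he, ht, E, h1, h2, hs⟩ := RAM.halts_splitUCT (n := n) (B := listStart adj n)
    (W := 20 * (n + G.edgeSet.ncard + k.natAbs + 1)) (k := k) (d := listLength adj)
    (a := listStart adj) (s := RAM.initial (inputWords adj k))
    (fun i hi => listStart_succ hi) hlt (fun i hi => listStart_mono hi) rfl (by omega) (by omega)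
    (fun _ => rfl) rfl rfl (fun i hi => getD_inputWords_add_two hi)
    (fun j => List.getD_eq_default _ _ (by rw [length_inputWords]; omega))
  refine ⟨t, s, he, by omega, ?_⟩
  simp only [← ncard_eq_count, hlen] at h1 h2 hs
  rw [upperCliqueTransversal_iff hG h1 h2, hs]
  exact ⟨fun h => if_pos h, fun h => if_neg h⟩
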